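/- Let $n\ge 3$, let $S^{n-1}=\{v\in\mathbb{R}^n:|v|=1\}$, and let $P$ be the normalized $(n-1)$-dimensional Hausdorff measure on $S^{n-1}$. For $s\in\mathbb{R}$ and $u\in S^{n-1}$ put $C_s(u)=\{v\in S^{n-1}:u\cdot v\ge s\}$. A sequence $(x_j)_{j\ge1}$ in $S^{n-1}$ is called uniformly distributed if $\lim_{N\to\infty}\frac1N\#\{1\le j\le N:x_j\in A\}=P(A)$ for every set $A\subseteq S^{n-1}$ whose relative boundary satisfies $P(\partial A)=0$. The $d$-dimensional Legendre polynomials are given by $P^d_0(t)=1$, $P^d_1(t)=t$ and $(k+d-1)P^d_{k+2}(t)=(2k+d)\,t\,P^d_{k+1}(t)-(k+1)P^d_k(t)$ for $k\ge 0$. Let $s$ be a real zero of an $(n+2)$-dimensional Legendre polynomial $P^{n+2}_k$ of even degree $k$. Then there exists a sequence $(x_j)_{j\ge1}$ in $S^{n-1}$ such that $$\lim_{N\to\infty}\frac1N\#\{1\le j\le N:x_j\in C_s(u)\}=P(C_s(u))\qquad\text{for every }u\in S^{n-1},$$ but $(x_j)$ is not uniformly distributed. -/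

import Mathlib

open MeasureTheory Filter Topology

namespace SphereCaps

/-- The `d`-dimensional Legendre polynomial of degree `k` (an ultraspherical polynomial of
parameter `(d - 2) / 2`, normalized to take the value `1` at `1`), given by the standard
three-term recurrence
`(k + d - 1) P_{k+2} = (2k + d) X P_{k+1} - (k + 1) P_k`, `P_0 = 1`, `P_1 = X`.
For `d = 3` these are the classical Legendre polynomials. It is used for `d ≥ 2` only. -/
noncomputable def legendrePoly (d : ℕ) : ℕ → Polynomial ℝ
  | 0 => 1
  | 1 => Polynomial.X
  | k + 2 =>
      Polynomial.C ((2 * (k : ℝ) + d) / ((k : ℝ) + d - 1)) * Polynomial.X * legendrePoly d (k + 1)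
        - Polynomial.C (((k : ℝ) + 1) / ((k : ℝ) + d - 1)) * legendrePoly d k

/-- The unit sphere `S^{n-1}` of the Euclidean space `ℝⁿ`. -/
abbrev UnitSphere (n : ℕ) : Type :=
  Metric.sphere (0 : EuclideanSpace ℝ (Fin n)) 1

/-- The normalized `(n-1)`-dimensional Hausdorff measure on `S^{n-1}`. -/
noncomputable def sphereProb (n : ℕ) : Measure (UnitSphere n) :=
  (Measure.hausdorffMeasure ((n : ℝ) - 1) (Set.univ : Set (UnitSphere n)))⁻¹ •
    (Measure.hausdorffMeasure ((n : ℝ) - 1) : Measure (UnitSphere n))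

/-- The spherical cap `C_s(u) = {v ∈ S^{n-1} : u · v ≥ s}`. -/
def cap {n : ℕ} (s : ℝ) (u : UnitSphere n) : Set (UnitSphere n) :=
  {v | s ≤ inner ℝ (u : EuclideanSpace ℝ (Fin n)) (v : EuclideanSpace ℝ (Fin n))}

/-- The relative frequency with which the first `N` terms of the sequence `x` lie in `A`. -/
noncomputable def frequency {X : Type*} (x : ℕ → X) (A : Set X) (N : ℕ) : ℝ :=
  (1 / (N : ℝ)) * ∑ j ∈ Finset.range N, A.indicator (fun _ => (1 : ℝ)) (x j)

/-- The sequence `x` is `Q`-uniformly distributed: for every `Q`-continuity set `A`, the frequency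
with which `x` visits `A` tends to `Q A`. -/
def IsUniformlyDistributed {X : Type*} [TopologicalSpace X] [MeasurableSpace X]
    (Q : Measure X) (x : ℕ → X) : Prop :=
  ∀ A : Set X, Q (frontier A) = 0 → Tendsto (frequency x A) atTop (𝓝 (Q.real A))

end SphereCaps

/-! It suffices to find a probability measure `ν ≠ P` with `ν ≪ P` that agrees with `P` on all caps
of height `s`: an i.i.d. sample from `ν` then almost surely has the right frequency on each cap but
the wrong one on some `P`-continuity set.

The density of `ν` is `1 + ε Q(e · x)`, where `Q` is a primitive, up to a nonzero factor, of the
given Legendre polynomial. The function `w(x) = Q(e · x)` satisfies `Δw = -l w` on the sphere with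
`l ≠ 0` (`exists_zonal_eigenfunction`), so its total integral is zero. Moreover `Q'(s) = 0`, while
`Q(s) ≠ 0` because consecutive Legendre polynomials share no zero.

The point is that `w` has zero integral over each cap `C_s(u)`
(`setIntegral_cap_zonal_eigenfunction`). Put `Φ = 1 - Q / Q(s)`, so that `Φ` and `Φ'` both vanish at
`s`. Then `v(x) = Φ(max (u · x) s)` is supported in the cap, has a Lipschitz gradient, and solves
`(Δ + l) v = l · 1_{C_s(u)}` almost everywhere. Pairing with `w` and using self-adjointness gives `l
∫_{C_s(u)} w = ∫ v (Δ + l) w = 0`.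

Green's formula is derived from rotation invariance of the measure alone
(`integral_fderiv_rotation`, `integral_green_zonal`), without charts. -/

namespace SphereCaps
-- Legendre polynomials and the eigenfunction profile.
open Polynomial in
theorem legendrePoly_recurrence (d : ℕ) (hd : 2 ≤ d) (k : ℕ) :
    C ((k : ℝ) + d - 1) * legendrePoly d (k + 2) =
      C (2 * (k : ℝ) + d) * X * legendrePoly d (k + 1) - C ((k : ℝ) + 1) * legendrePoly d k := by
  have h : ((k : ℝ) + d - 1) ≠ 0 := by
    have : (2 : ℝ) ≤ d := by exact_mod_cast hd
    have : (0 : ℝ) ≤ k := k.cast_nonneg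
    linarith
  rw [legendrePoly, mul_sub, ← mul_assoc, ← mul_assoc, ← mul_assoc, ← C_mul, ← C_mul,
    mul_div_cancel₀ _ h, mul_div_cancel₀ _ h]

open Polynomial in
-- The two ladder relations are proved jointly: the first advances by differentiating the recurrence
-- and using both, the second by adding the recurrence to the first.
theorem legendrePoly_derivative (d : ℕ) (hd : 2 ≤ d) (k : ℕ) :
    (1 - X ^ 2) * derivative (legendrePoly d (k + 1)) =
        C ((k : ℝ) + 1) * (legendrePoly d k - X * legendrePoly d (k + 1)) ∧
      (1 - X ^ 2) * derivative (legendrePoly d k) =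
        C ((k : ℝ) + d - 2) * (X * legendrePoly d k - legendrePoly d (k + 1)) := by
  induction k with
  | zero => simp [legendrePoly]; ring
  | succ k ih =>
    obtain ⟨h1, h2⟩ := ih
    have hr := legendrePoly_recurrence d hd k
    have hc : C ((k : ℝ) + d - 1) ≠ 0 := by
      have : (2 : ℝ) ≤ d := by exact_mod_cast hd
      have : (0 : ℝ) ≤ k := k.cast_nonneg
      rw [Ne, C_eq_zero]; linarith
    have hr' := congrArg derivative hr
    simp only [derivative_mul, derivative_sub, derivative_C, derivative_X, zero_mul, zero_add,
      mul_one] at hr'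
    have e : k + 1 + 1 = k + 2 := rfl
    simp only [e]
    generalize derivative (legendrePoly d (k + 2)) = r' at *
    generalize derivative (legendrePoly d (k + 1)) = q' at *
    generalize derivative (legendrePoly d k) = p' at *
    generalize legendrePoly d (k + 2) = r at *
    generalize legendrePoly d (k + 1) = q at *
    generalize legendrePoly d k = p at *
    simp only [C_add, C_sub, C_mul, C_1, Nat.cast_add, Nat.cast_one, C_ofNat] at *
    generalize (C (k : ℝ) : ℝ[X]) = K at *
    generalize (C (d : ℝ) : ℝ[X]) = D at *
    constructor
    · apply mul_left_cancel₀ hc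
      linear_combination (1 - X ^ 2) * hr' + (2 * K + D) * X * h1 - (K + 1) * h2 +
        (K + 2) * X * hr
    · linear_combination h1 + hr

open Polynomial in
/-- A primitive, up to a factor, of the Legendre polynomial of degree `k + 1`. -/
noncomputable def legendrePrimitive (d k : ℕ) : ℝ[X] :=
  C ((k : ℝ) + d - 2) * X * legendrePoly d (k + 1) - C ((k : ℝ) + 1) * legendrePoly d k

open Polynomial in
theorem legendrePrimitive_derivative (d : ℕ) (hd : 2 ≤ d) (k : ℕ) :
    derivative (legendrePrimitive d k) =
      C (((k : ℝ) + 2) * ((k : ℝ) + d - 2)) * legendrePoly d (k + 1) := by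
  obtain ⟨h1, h2⟩ := legendrePoly_derivative d hd k
  have hx : (1 - X ^ 2 : ℝ[X]) ≠ 0 := by
    intro h
    simpa using congrArg (eval 0) h
  apply mul_left_cancel₀ hx
  simp only [legendrePrimitive, derivative_mul, derivative_sub, derivative_C, derivative_X,
    zero_mul, zero_add, mul_one]
  simp only [C_add, C_sub, C_mul, C_1, C_ofNat] at *
  linear_combination (C (k : ℝ) + C (d : ℝ) - 2) * X * h1 - (C (k : ℝ) + 1) * h2

-- For `d = n + 2`, multiplying by the constant in `legendrePrimitive_derivative` turns this into
-- the eigenvalue equation of the zonal Laplacian on the sphere in dimension `n`.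
open Polynomial in
theorem legendrePrimitive_eq (d : ℕ) (hd : 2 ≤ d) (k : ℕ) :
    legendrePrimitive d k = C ((d : ℝ) - 3) * X * legendrePoly d (k + 1) -
      (1 - X ^ 2) * derivative (legendrePoly d (k + 1)) := by
  obtain ⟨h1, -⟩ := legendrePoly_derivative d hd k
  rw [h1, legendrePrimitive]
  simp only [C_add, C_sub, C_1, C_ofNat] at *
  ring

/-- Two consecutive zeros at `s` would propagate down the recurrence to `P_0 = 1`. -/
theorem legendrePoly_eval_ne_zero (d : ℕ) (hd : 2 ≤ d) (k : ℕ) (s : ℝ)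
    (h : (legendrePoly d (k + 1)).eval s = 0) : (legendrePoly d k).eval s ≠ 0 := by
  induction k with
  | zero => simp [legendrePoly]
  | succ k ih =>
    intro h0
    apply ih h0
    have hr := congrArg (Polynomial.eval s) (legendrePoly_recurrence d hd k)
    simp only [Polynomial.eval_mul, Polynomial.eval_C, Polynomial.eval_sub, h, h0, mul_zero,
      zero_sub] at hr
    have : (k : ℝ) + 1 ≠ 0 := by positivity
    have h2 : ((k : ℝ) + 1) * (legendrePoly d k).eval s = 0 := by linarith
    exact (mul_eq_zero.1 h2).resolve_left this

/-- A nonconstant zonal eigenfunction of the spherical Laplacian, with a prescribed critical point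
that is not a zero. -/
theorem exists_zonal_eigenfunction (n : ℕ) (hn : 3 ≤ n) (k : ℕ) (s : ℝ)
    (hs : (legendrePoly (n + 2) k).IsRoot s) :
    ∃ (Q : Polynomial ℝ) (l : ℝ), l ≠ 0 ∧ Q ≠ 0 ∧ Q.eval s ≠ 0 ∧ Q.derivative.eval s = 0 ∧
      ∀ t, (1 - t ^ 2) * Q.derivative.derivative.eval t - (n - 1) * t * Q.derivative.eval t
        = - l * Q.eval t := by
  obtain _ | k := k
  · simp [legendrePoly] at hs
  have hl : ((k : ℝ) + 2) * ((k : ℝ) + (n + 2 : ℕ) - 2) ≠ 0 := by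
    push_cast
    have : (3 : ℝ) ≤ n := by exact_mod_cast hn
    have : (0 : ℝ) ≤ k := k.cast_nonneg
    refine mul_ne_zero ?_ ?_ <;> linarith
  have hQs : (legendrePrimitive (n + 2) k).eval s ≠ 0 := by
    have := legendrePoly_eval_ne_zero (n + 2) (by omega) k s hs
    simp only [legendrePrimitive, Polynomial.eval_mul, Polynomial.eval_C, Polynomial.eval_sub,
      show (legendrePoly (n + 2) (k + 1)).eval s = 0 from hs, mul_zero, zero_sub]
    exact neg_ne_zero.2 (mul_ne_zero (by positivity) this)
  refine ⟨legendrePrimitive (n + 2) k, _, hl, ?_, hQs, ?_, ?_⟩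
  · rintro h
    simp [h] at hQs
  · rw [legendrePrimitive_derivative _ (by omega), Polynomial.eval_mul,
      show (legendrePoly (n + 2) (k + 1)).eval s = 0 from hs, mul_zero]
  · intro t
    have h2 := congrArg (Polynomial.eval t) (legendrePrimitive_eq (n + 2) (by omega) k)
    rw [legendrePrimitive_derivative _ (by omega)]
    simp only [Polynomial.derivative_mul, Polynomial.derivative_C, zero_mul, zero_add,
      Polynomial.eval_mul, Polynomial.eval_C, Polynomial.eval_sub, Polynomial.eval_X,
      Polynomial.eval_one, Polynomial.eval_pow] at h2 ⊢
    push_cast at *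
    rw [h2]
    ring

/-! ### Sequences distributed according to a given probability measure. -/

/-- Averages along a sequence converge for every continuous function if they do on a dense set. -/
theorem tendsto_average_of_dense {X : Type*} [TopologicalSpace X] [CompactSpace X]
    [MeasurableSpace X] [BorelSpace X] (ν : Measure X) [IsProbabilityMeasure ν] (x : ℕ → X)
    (D : Set C(X, ℝ)) (hD : Dense D)
    (h : ∀ f ∈ D, Tendsto (fun N : ℕ => (∑ j ∈ Finset.range N, f (x j)) / N) atTop
      (𝓝 (∫ y, f y ∂ν))) (f : C(X, ℝ)) :
    Tendsto (fun N : ℕ => (∑ j ∈ Finset.range N, f (x j)) / N) atTop (𝓝 (∫ y, f y ∂ν)) := by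
  have hint : ∀ g : C(X, ℝ), Integrable g ν := fun g =>
    (BoundedContinuousFunction.mkOfCompact g).integrable ν
  rw [Metric.tendsto_atTop]
  intro ε hε
  obtain ⟨g, hg, hgD⟩ := Metric.dense_iff.1 hD f (ε / 3) (by positivity)
  rw [Metric.mem_ball, dist_comm, ContinuousMap.dist_lt_iff (by positivity)] at hg
  obtain ⟨N₀, hN₀⟩ := (Metric.tendsto_atTop.1 (h g hgD)) (ε / 3) (by positivity)
  refine ⟨N₀, fun N hN => ?_⟩
  have h1 : |(∑ j ∈ Finset.range N, f (x j)) / N - (∑ j ∈ Finset.range N, g (x j)) / N|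
      ≤ ε / 3 := by
    rw [← sub_div, ← Finset.sum_sub_distrib, abs_div, Nat.abs_cast]
    apply div_le_of_le_mul₀ (by positivity) (by positivity)
    refine (Finset.abs_sum_le_sum_abs _ _).trans ?_
    refine (Finset.sum_le_card_nsmul _ _ (ε / 3) fun j _ => (hg (x j)).le).trans ?_
    simp [mul_comm]
  have h2 := hN₀ N hN
  have h3 : |∫ y, f y ∂ν - ∫ y, g y ∂ν| ≤ ε / 3 := by
    rw [← integral_sub (hint f) (hint g)]
    refine (norm_integral_le_of_norm_le_const (C := ε / 3)
      (Eventually.of_forall fun y => (Real.norm_eq_abs _).trans_le (hg y).le)).trans ?_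
    simp
  rw [Real.dist_eq] at h2 ⊢
  rw [abs_le] at h1 h3
  rw [abs_lt] at h2 ⊢
  constructor <;> linarith

/-- The strong law of large numbers for an i.i.d. sample holds almost surely for all functions of a
countable dense subset of `C(X, ℝ)` at once; any such sample point works. -/
theorem exists_seq_tendsto_average {X : Type*} [TopologicalSpace X] [CompactSpace X]
    [SecondCountableTopology X] [T2Space X]
    [MeasurableSpace X] [BorelSpace X] (ν : Measure X) [IsProbabilityMeasure ν] :
    ∃ x : ℕ → X, ∀ f : C(X, ℝ),
      Tendsto (fun N : ℕ => (∑ j ∈ Finset.range N, f (x j)) / N) atTop (𝓝 (∫ y, f y ∂ν)) := by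
  obtain ⟨Ω, _, P, Y, hm, hlaw, hind, hP⟩ := ProbabilityTheory.exists_iid ℕ ν
  obtain ⟨D, hDc, hD⟩ := TopologicalSpace.exists_countable_dense C(X, ℝ)
  have key : ∀ f ∈ D, ∀ᵐ ω ∂P, Tendsto
      (fun N : ℕ => (∑ j ∈ Finset.range N, f (Y j ω)) / N) atTop (𝓝 (∫ y, f y ∂ν)) := by
    intro f _
    have hf : Measurable f := f.continuous.measurable
    have hi : Integrable (fun ω => f (Y 0 ω)) P := by
      have := (BoundedContinuousFunction.mkOfCompact f).integrable ν
      rw [← (hlaw 0).map_eq] at this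
      exact this.comp_measurable (hm 0)
    have := ProbabilityTheory.strong_law_ae_real (fun j ω => f (Y j ω)) hi
      (fun i j hij => (hind.indepFun hij).comp hf hf)
      (fun i => by
        have : ProbabilityTheory.IdentDistrib (Y i) (Y 0) P P :=
          ⟨(hm i).aemeasurable, (hm 0).aemeasurable, by rw [(hlaw i).map_eq, (hlaw 0).map_eq]⟩
        exact this.comp hf)
    rwa [show ∫ ω, f (Y 0 ω) ∂P = ∫ y, f y ∂ν by
      rw [← (hlaw 0).map_eq, integral_map (hm 0).aemeasurable hf.aestronglyMeasurable]] at this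
  obtain ⟨ω, hω⟩ := ((ae_ball_iff hDc).2 key).exists
  exact ⟨fun j => Y j ω, tendsto_average_of_dense ν _ D hD hω⟩

/-- The empirical measures converge weakly to `ν`, and the portmanteau theorem applies to continuity
sets. -/
theorem isUniformlyDistributed_of_tendsto_average {X : Type*} [TopologicalSpace X]
    [CompactSpace X] [HasOuterApproxClosed X]
    [MeasurableSpace X] [BorelSpace X] (ν : Measure X) [IsProbabilityMeasure ν] (x : ℕ → X)
    (h : ∀ f : C(X, ℝ),
      Tendsto (fun N : ℕ => (∑ j ∈ Finset.range N, f (x j)) / N) atTop (𝓝 (∫ y, f y ∂ν))) :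
    ∀ A : Set X, MeasurableSet A → ν (frontier A) = 0 →
      Tendsto (frequency x A) atTop (𝓝 (ν.real A)) := by
  intro A hA hfr
  -- The shift to `N + 1` points makes every empirical measure a probability measure.
  let m : ℕ → Measure X := fun N =>
    ((N + 1 : ℕ) : ENNReal)⁻¹ • ∑ j ∈ Finset.range (N + 1), Measure.dirac (x j)
  have hm : ∀ N, IsProbabilityMeasure (m N) := fun N => by
    constructor
    simp only [m, Measure.smul_apply, Measure.coe_finsetSum, Finset.sum_apply, smul_eq_mul,
      measure_univ, Finset.sum_const, Finset.card_range, nsmul_eq_mul, mul_one]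
    exact ENNReal.inv_mul_cancel (by simp) (ENNReal.natCast_ne_top _)
  let ν' : ProbabilityMeasure X := ⟨ν, inferInstance⟩
  let M : ℕ → ProbabilityMeasure X := fun N => ⟨m N, hm N⟩
  have hM : Tendsto M atTop (𝓝 ν') := by
    rw [ProbabilityMeasure.tendsto_iff_forall_integral_tendsto]
    intro f
    have := (h f.toContinuousMap).comp (tendsto_add_atTop_nat 1)
    refine this.congr fun N => ?_
    have hi : ∀ j ∈ Finset.range (N + 1), Integrable f (Measure.dirac (x j)) :=
      fun j _ => f.integrable _
    change _ = ∫ y, f y ∂(m N)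
    simp only [m]
    rw [integral_smul_measure, integral_finsetSum_measure hi]
    simp only [integral_dirac' f _ f.continuous.stronglyMeasurable, ENNReal.toReal_inv,
      ENNReal.toReal_natCast, smul_eq_mul, Function.comp_apply, div_eq_inv_mul]
    rfl
  have := ProbabilityMeasure.tendsto_measure_of_null_frontier_of_tendsto' hM (E := A) hfr
  have h2 := (ENNReal.tendsto_toReal (measure_ne_top ν A)).comp this
  rw [← tendsto_add_atTop_iff_nat 1]
  refine h2.congr fun N => ?_
  change (m N A).toReal = _
  simp only [m, frequency, Measure.smul_apply, Measure.coe_finsetSum, Finset.sum_apply,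
    smul_eq_mul, Measure.dirac_apply' _ hA, ENNReal.toReal_mul]
  rw [ENNReal.toReal_sum (fun j _ => by by_cases hj : x j ∈ A <;> simp [hj])]
  congr 1
  · rw [ENNReal.toReal_inv, ENNReal.toReal_natCast, one_div]
  · refine Finset.sum_congr rfl fun j _ => ?_
    by_cases hj : x j ∈ A <;> simp [hj]

/-! ### Rotation invariance and integration by parts on the sphere. -/

/-- The action of a linear isometry on the unit sphere. -/
noncomputable def sphereIsometry {n : ℕ}
    (L : EuclideanSpace ℝ (Fin n) ≃ₗᵢ[ℝ] EuclideanSpace ℝ (Fin n)) :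
    UnitSphere n ≃ᵢ UnitSphere n where
  toFun x := ⟨L x, by simp⟩
  invFun x := ⟨L.symm x, by simp⟩
  left_inv x := by simp
  right_inv x := by simp
  isometry_toFun := Isometry.of_dist_eq fun x y => L.dist_map x y

/-- Invariance of a measure on the sphere under all linear isometries. -/
def IsRotationInvariant {n : ℕ} (μ : Measure (UnitSphere n)) : Prop :=
  ∀ L : EuclideanSpace ℝ (Fin n) ≃ₗᵢ[ℝ] EuclideanSpace ℝ (Fin n),
    MeasurePreserving (sphereIsometry L) μ μ

theorem isRotationInvariant_sphereProb (n : ℕ) : IsRotationInvariant (sphereProb n) := fun L =>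
  ((sphereIsometry L).measurePreserving_hausdorffMeasure _).smul_measure _

theorem exists_isometry_exp {n : ℕ}
    (A : EuclideanSpace ℝ (Fin n) →L[ℝ] EuclideanSpace ℝ (Fin n))
    (hA : ∀ x y, inner ℝ (A x) y = - inner ℝ x (A y)) :
    ∃ R : ℝ → (EuclideanSpace ℝ (Fin n) ≃ₗᵢ[ℝ] EuclideanSpace ℝ (Fin n)),
      (∀ x, R 0 x = x) ∧ ∀ x t, HasDerivAt (fun t => R t x) (A (R t x)) t := by
  have hs : ∀ t : ℝ, t • A ∈ skewAdjoint _ := fun t => by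
    rw [skewAdjoint.mem_iff, ContinuousLinearMap.star_eq_adjoint, eq_comm,
      ContinuousLinearMap.eq_adjoint_iff]
    intro x y
    simp [inner_smul_left, inner_smul_right, hA]
  let : NormedAlgebra ℚ (EuclideanSpace ℝ (Fin n) →L[ℝ] EuclideanSpace ℝ (Fin n)) :=
    NormedAlgebra.restrictScalars ℚ ℝ _
  refine ⟨fun t => Unitary.linearIsometryEquiv
    ⟨NormedSpace.exp (t • A), NormedSpace.exp_mem_unitary_of_mem_skewAdjoint (hs t)⟩, ?_, ?_⟩
  · intro x
    have h0 : NormedSpace.exp ((0 : ℝ) • A) = 1 := by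
      rw [show (0 : ℝ) • A = 0 from zero_smul ℝ A, NormedSpace.exp_zero]
    exact congrArg (fun B => B x) h0
  · intro x t
    have := hasDerivAt_exp_smul_const' (𝕂 := ℝ) A t
    exact ((ContinuousLinearMap.apply ℝ _ x).hasFDerivAt.comp_hasDerivAt t this)

/-- The infinitesimal form of invariance: tangential derivatives along rotations integrate to
zero. -/
theorem integral_fderiv_rotation {n : ℕ} (μ : Measure (UnitSphere n)) [IsFiniteMeasure μ]
    (hμ : IsRotationInvariant μ)
    (A : EuclideanSpace ℝ (Fin n) →L[ℝ] EuclideanSpace ℝ (Fin n))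
    (hA : ∀ x y, inner ℝ (A x) y = - inner ℝ x (A y))
    (g : EuclideanSpace ℝ (Fin n) → ℝ) (K : NNReal) (hg : LipschitzOnWith K g (Metric.sphere 0 1))
    (g' : UnitSphere n → (EuclideanSpace ℝ (Fin n) →L[ℝ] ℝ))
    (hd : ∀ᵐ x ∂μ, HasFDerivAt g (g' x) x)
    (hm : AEStronglyMeasurable (fun x => g' x (A x)) μ) :
    Integrable (fun x => g' x (A x)) μ ∧ ∫ x, g' x (A x) ∂μ = 0 := by
  obtain ⟨R, hR0, hR⟩ := exists_isometry_exp A hA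
  have hgc : Continuous (fun x : UnitSphere n => g x) :=
    continuousOn_iff_continuous_domRestrict.1 hg.continuousOn
  have hRx : ∀ (x : UnitSphere n) t, R t x ∈ Metric.sphere (0 : EuclideanSpace ℝ (Fin n)) 1 :=
    fun x t => by simp
  have hbd : ∀ (x : UnitSphere n), LipschitzWith (‖A‖₊) (fun t => R t x) := fun x => by
    refine lipschitzWith_of_nnnorm_deriv_le (fun t => (hR x t).differentiableAt) fun t => ?_
    rw [(hR x t).deriv, ← NNReal.coe_le_coe]
    simpa using A.le_opNorm (R t x)
  -- Differentiation under the integral along the flow `R t = exp (t A)`; the Lipschitz constants of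
  -- `g` and of the orbits supply the dominating bound.
  have key := hasDerivAt_integral_of_dominated_loc_of_lip (μ := μ) (x₀ := (0 : ℝ))
    (F := fun t x => g (R t x)) (F' := fun x => g' x (A x)) (s := Set.univ)
    (bound := fun _ => (K * ‖A‖₊ : NNReal)) univ_mem
    (Eventually.of_forall fun t =>
      (hgc.comp (sphereIsometry (R t)).continuous).aestronglyMeasurable)
    (by
      simp only [hR0]
      exact (BoundedContinuousFunction.mkOfCompact ⟨_, hgc⟩).integrable μ)
    hm
    (Eventually.of_forall fun x => by
      rw [Real.nnabs_of_nonneg (by positivity), Real.toNNReal_coe]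
      exact hg.comp ((hbd x).lipschitzOnWith) (fun t _ => hRx x t))
    (integrable_const _)
    (by
      filter_upwards [hd] with x hx
      have h1 := hR x 0
      rw [hR0] at h1
      refine HasFDerivAt.comp_hasDerivAt (0 : ℝ) (l := g) (l' := g' x) ?_ h1
      rw [hR0]
      exact hx)
  refine ⟨key.1, ?_⟩
  have hc : (fun t => ∫ x, g (R t x) ∂μ) = fun _ => ∫ x : UnitSphere n, g x ∂μ := by
    funext t
    exact (hμ (R t)).integral_comp (sphereIsometry (R t)).toHomeomorph.measurableEmbedding
      (fun x : UnitSphere n => g x)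
  rw [hc] at key
  exact key.2.unique (hasDerivAt_const _ _)

theorem exists_lipschitzOnWith_mul {α : Type*} [PseudoMetricSpace α] {s : Set α}
    (hs : IsCompact s) {f g : α → ℝ} (hf : ∃ K, LipschitzOnWith K f s)
    (hg : ∃ K, LipschitzOnWith K g s) : ∃ K, LipschitzOnWith K (fun x => f x * g x) s := by
  obtain ⟨K, hf⟩ := hf
  obtain ⟨L, hg⟩ := hg
  obtain ⟨M, hM⟩ := hs.exists_bound_of_continuousOn hf.continuousOn
  obtain ⟨N, hN⟩ := hs.exists_bound_of_continuousOn hg.continuousOn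
  refine ⟨(|M| * L + |N| * K).toNNReal, LipschitzOnWith.of_dist_le_mul fun x hx y hy => ?_⟩
  rw [Real.coe_toNNReal _ (by positivity), Real.dist_eq]
  have h1 := hf.dist_le_mul x hx y hy
  have h2 := hg.dist_le_mul x hx y hy
  rw [Real.dist_eq] at h1 h2
  have h3 : |f x| ≤ |M| := (hM x hx).trans (le_abs_self _)
  have h4 : |g y| ≤ |N| := (hN y hy).trans (le_abs_self _)
  calc |f x * g x - f y * g y| = |f x * (g x - g y) + (f x - f y) * g y| := by ring_nf
    _ ≤ |f x| * |g x - g y| + |f x - f y| * |g y| := by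
      rw [← abs_mul, ← abs_mul]; exact abs_add_le _ _
    _ ≤ |M| * (L * dist x y) + K * dist x y * |N| := by gcongr
    _ = _ := by ring

theorem inner_mem_Icc {n : ℕ} (u x : UnitSphere n) :
    inner ℝ (u : EuclideanSpace ℝ (Fin n)) (x : EuclideanSpace ℝ (Fin n)) ∈ Set.Icc (-1 : ℝ) 1 := by
  have := abs_real_inner_le_norm (u : EuclideanSpace ℝ (Fin n)) x
  simpa [abs_le] using this

theorem inner_self_sphere {n : ℕ} (u : UnitSphere n) :
    inner ℝ (u : EuclideanSpace ℝ (Fin n)) (u : EuclideanSpace ℝ (Fin n)) = 1 := by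
  simp

theorem exists_lipschitzOnWith_zonal {n : ℕ} (u : UnitSphere n) {ψ : ℝ → ℝ}
    (hψ : ∃ K, LipschitzOnWith K ψ (Set.Icc (-1) 1)) :
    ∃ K, LipschitzOnWith K (fun x => ψ (inner ℝ (u : EuclideanSpace ℝ (Fin n)) x))
      (Metric.sphere 0 1) := by
  obtain ⟨K, hK⟩ := hψ
  exact ⟨_, hK.comp ((innerSL ℝ (u : EuclideanSpace ℝ (Fin n))).lipschitz.lipschitzOnWith)
    fun x hx => inner_mem_Icc u ⟨x, hx⟩⟩

theorem sum_mul_eq_inner {n : ℕ} (u x : EuclideanSpace ℝ (Fin n)) :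
    ∑ i, x i * u i = inner ℝ u x := by
  simp [PiLp.inner_apply]

theorem integral_zonal_rotation {n : ℕ} (μ : Measure (UnitSphere n)) [IsFiniteMeasure μ]
    (hμ : IsRotationInvariant μ) (u e : UnitSphere n) (ψ χ ψ' χ' : ℝ → ℝ)
    (hψ : ∃ K, LipschitzOnWith K ψ (Set.Icc (-1) 1))
    (hχ : ∃ K, LipschitzOnWith K χ (Set.Icc (-1) 1))
    (hψd : ∀ᵐ x : UnitSphere n ∂μ, HasDerivAt ψ (ψ' (inner ℝ u.1 x.1)) (inner ℝ u.1 x.1))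
    (hχd : ∀ᵐ x : UnitSphere n ∂μ, HasDerivAt χ (χ' (inner ℝ e.1 x.1)) (inner ℝ e.1 x.1))
    (hψm : Measurable ψ') (hχm : Measurable χ') (i : Fin n) :
    let G := fun x : UnitSphere n =>
      ψ (inner ℝ u.1 x.1) * x.1 i *
        (χ' (inner ℝ e.1 x.1) * (inner ℝ u.1 x.1 * e.1 i - x.1 i * inner ℝ e.1 u.1)) +
      χ (inner ℝ e.1 x.1) * (ψ (inner ℝ u.1 x.1) * (inner ℝ u.1 x.1 - x.1 i * u.1 i) +
        x.1 i * (ψ' (inner ℝ u.1 x.1) * (inner ℝ u.1 x.1 * u.1 i - x.1 i)))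
    Integrable G μ ∧ ∫ x, G x ∂μ = 0 := by
  intro G
  let A : EuclideanSpace ℝ (Fin n) →L[ℝ] EuclideanSpace ℝ (Fin n) :=
    (innerSL ℝ u.1).smulRight (EuclideanSpace.single i 1) -
      (EuclideanSpace.proj i : EuclideanSpace ℝ (Fin n) →L[ℝ] ℝ).smulRight u.1
  let g : EuclideanSpace ℝ (Fin n) → ℝ := fun x =>
    ψ (inner ℝ u.1 x) * x i * χ (inner ℝ e.1 x)
  let g' : UnitSphere n → (EuclideanSpace ℝ (Fin n) →L[ℝ] ℝ) := fun x =>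
    (ψ (inner ℝ u.1 x.1) * x.1 i) • (χ' (inner ℝ e.1 x.1) • innerSL ℝ e.1) +
    χ (inner ℝ e.1 x.1) • (ψ (inner ℝ u.1 x.1) • (EuclideanSpace.proj i) +
      x.1 i • (ψ' (inner ℝ u.1 x.1) • innerSL ℝ u.1))
  have hc : IsCompact (Metric.sphere (0 : EuclideanSpace ℝ (Fin n)) 1) := isCompact_sphere 0 1
  have hproj : ∃ K, LipschitzOnWith K (fun x : EuclideanSpace ℝ (Fin n) => x i)
      (Metric.sphere 0 1) :=
    ⟨_, ((EuclideanSpace.proj i : EuclideanSpace ℝ (Fin n) →L[ℝ] ℝ)).lipschitz.lipschitzOnWith⟩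
  obtain ⟨K, hK⟩ := exists_lipschitzOnWith_mul hc (exists_lipschitzOnWith_mul hc
    (exists_lipschitzOnWith_zonal u hψ) hproj) (exists_lipschitzOnWith_zonal e hχ)
  have hG : (fun x => g' x (A x)) = G := by
    funext x
    have hA : A x = (inner ℝ u.1 x.1 : ℝ) • EuclideanSpace.single i 1 - x.1 i • u.1 := rfl
    have hi : (A x) i = inner ℝ u.1 x.1 - x.1 i * u.1 i := by simp [hA]
    have hin : ∀ v : EuclideanSpace ℝ (Fin n),
        inner ℝ v (A x) = inner ℝ u.1 x.1 * v i - x.1 i * inner ℝ v u.1 := fun v => by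
      simp [hA, inner_sub_right, inner_smul_right, EuclideanSpace.inner_single_right]
    change ψ (inner ℝ u.1 x.1) * x.1 i * (χ' (inner ℝ e.1 x.1) * inner ℝ e.1 (A x)) +
      χ (inner ℝ e.1 x.1) * (ψ (inner ℝ u.1 x.1) * (A x) i +
        x.1 i * (ψ' (inner ℝ u.1 x.1) * inner ℝ u.1 (A x))) = _
    rw [hi, hin, hin, inner_self_sphere, mul_one]
  have hcont : ∀ v : UnitSphere n, Continuous fun x : UnitSphere n => (inner ℝ v.1 x.1 : ℝ) :=
    fun v => continuous_const.inner continuous_subtype_val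
  have hcomp : ∀ (v : UnitSphere n) (f : ℝ → ℝ), (∃ K, LipschitzOnWith K f (Set.Icc (-1) 1)) →
      Measurable fun x : UnitSphere n => f (inner ℝ v.1 x.1) := by
    rintro v f ⟨K, hK⟩
    exact (hK.continuousOn.comp_continuous (hcont v) fun x => inner_mem_Icc v x).measurable
  have hmG : Measurable G := by
    have h1 := hcomp u ψ hψ
    have h2 := hcomp e χ hχ
    have h3 := (hcont u).measurable
    have h4 := hψm.comp h3
    have h5 := hχm.comp (hcont e).measurable
    have h6 : Measurable fun x : UnitSphere n => x.1 i := by fun_prop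
    simp only [Function.comp_def] at h4 h5
    exact ((h1.mul h6).mul (h5.mul ((h3.mul_const _).sub (h6.mul_const _)))).add
      (h2.mul ((h1.mul (h3.sub (h6.mul_const _))).add
        (h6.mul (h4.mul ((h3.mul_const _).sub h6)))))
  rw [← hG] at hmG ⊢
  refine integral_fderiv_rotation μ hμ A ?_ g K hK g' ?_ hmG.aestronglyMeasurable
  · intro x y
    simp [A, inner_sub_left, inner_sub_right, inner_smul_left, inner_smul_right]
    simp [real_inner_comm, EuclideanSpace.inner_single_right]
    ring
  · filter_upwards [hψd, hχd] with x h1 h2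
    have h1' := h1.comp_hasFDerivAt x.1 (innerSL ℝ u.1).hasFDerivAt
    have h2' := h2.comp_hasFDerivAt x.1 (innerSL ℝ e.1).hasFDerivAt
    exact (h1'.mul (EuclideanSpace.proj i : EuclideanSpace ℝ (Fin n) →L[ℝ] ℝ).hasFDerivAt).mul h2'

/-- Green's formula on the sphere for two zonal functions, one of them given by its derivative. -/
theorem integral_green_zonal {n : ℕ} (μ : Measure (UnitSphere n)) [IsFiniteMeasure μ]
    (hμ : IsRotationInvariant μ) (u e : UnitSphere n) (ψ χ ψ' χ' : ℝ → ℝ)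
    (hψ : ∃ K, LipschitzOnWith K ψ (Set.Icc (-1) 1))
    (hχ : ∃ K, LipschitzOnWith K χ (Set.Icc (-1) 1))
    (hψd : ∀ᵐ x : UnitSphere n ∂μ, HasDerivAt ψ (ψ' (inner ℝ u.1 x.1)) (inner ℝ u.1 x.1))
    (hχd : ∀ᵐ x : UnitSphere n ∂μ, HasDerivAt χ (χ' (inner ℝ e.1 x.1)) (inner ℝ e.1 x.1))
    (hψm : Measurable ψ') (hχm : Measurable χ') :
    let F := fun x : UnitSphere n =>
      ((1 - inner ℝ u.1 x.1 ^ 2) * ψ' (inner ℝ u.1 x.1) -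
        (n - 1) * inner ℝ u.1 x.1 * ψ (inner ℝ u.1 x.1)) * χ (inner ℝ e.1 x.1) +
      ψ (inner ℝ u.1 x.1) * χ' (inner ℝ e.1 x.1) *
        (inner ℝ u.1 e.1 - inner ℝ u.1 x.1 * inner ℝ e.1 x.1)
    Integrable F μ ∧ ∫ x, F x ∂μ = 0 := by
  intro F
  have key := fun i => integral_zonal_rotation μ hμ u e ψ χ ψ' χ' hψ hχ hψd hχd hψm hχm i
  simp only at key
  have hF : F = fun x : UnitSphere n => - ∑ i, (
      ψ (inner ℝ u.1 x.1) * x.1 i *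
        (χ' (inner ℝ e.1 x.1) * (inner ℝ u.1 x.1 * e.1 i - x.1 i * inner ℝ e.1 u.1)) +
      χ (inner ℝ e.1 x.1) * (ψ (inner ℝ u.1 x.1) * (inner ℝ u.1 x.1 - x.1 i * u.1 i) +
        x.1 i * (ψ' (inner ℝ u.1 x.1) * (inner ℝ u.1 x.1 * u.1 i - x.1 i)))) := by
    funext x
    have h1 := sum_mul_eq_inner u.1 x.1
    have h2 := sum_mul_eq_inner e.1 x.1
    have h3 := sum_mul_eq_inner x.1 x.1
    rw [inner_self_sphere] at h3
    have hue := real_inner_comm u.1 e.1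
    simp only [F]
    rw [← hue]
    generalize (inner ℝ u.1 x.1 : ℝ) = t at *
    generalize (inner ℝ e.1 x.1 : ℝ) = τ at *
    generalize (inner ℝ e.1 u.1 : ℝ) = ρ at *
    have : ∀ i, ψ t * x.1 i * (χ' τ * (t * e.1 i - x.1 i * ρ)) +
        χ τ * (ψ t * (t - x.1 i * u.1 i) + x.1 i * (ψ' t * (t * u.1 i - x.1 i))) =
        ψ t * χ' τ * t * (x.1 i * e.1 i) - (ψ t * χ' τ * ρ + χ τ * ψ' t) * (x.1 i * x.1 i)
        + χ τ * ψ t * t + (χ τ * ψ' t * t - χ τ * ψ t) * (x.1 i * u.1 i) := fun i => by ring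
    simp only [this, Finset.sum_add_distrib, Finset.sum_sub_distrib, ← Finset.mul_sum, h1, h2, h3,
      Finset.sum_const, Finset.card_univ, Fintype.card_fin, nsmul_eq_mul]
    ring
  rw [hF]
  refine ⟨(integrable_finsetSum _ fun i _ => (key i).1).neg, ?_⟩
  rw [integral_neg, integral_finsetSum _ fun i _ => (key i).1]
  simp [key]

theorem exists_lipschitzOnWith_Icc {f : ℝ → ℝ} (hf : LocallyLipschitz f) :
    ∃ K, LipschitzOnWith K f (Set.Icc (-1) 1) :=
  hf.locallyLipschitzOn.exists_lipschitzOnWith_of_compact isCompact_Icc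

/-- For `r² ≠ 1`, Green's formula is applied with `χ = 1` and profiles `ψ m` that tend to zero while
their derivatives converge boundedly to the indicator of `{r}`. In the limit `(1 - r²) μ{u · x = r}
= 0`. For `r² = 1` the level set has at most one point. -/
theorem measure_zonal_level_eq_zero {n : ℕ} (μ : Measure (UnitSphere n)) [IsFiniteMeasure μ]
    [NullSingletonClass μ] (hμ : IsRotationInvariant μ) (u : UnitSphere n) (r : ℝ) :
    μ {x | (inner ℝ u.1 x.1 : ℝ) = r} = 0 := by
  have hcont : Continuous fun x : UnitSphere n => (inner ℝ u.1 x.1 : ℝ) :=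
    continuous_const.inner continuous_subtype_val
  have hmeas : MeasurableSet {x : UnitSphere n | (inner ℝ u.1 x.1 : ℝ) = r} :=
    (isClosed_eq hcont continuous_const).measurableSet
  by_cases hr : r ^ 2 = 1
  · refine Set.Subsingleton.measure_zero ?_ μ
    have : ∀ x : UnitSphere n, (inner ℝ u.1 x.1 : ℝ) = r → x.1 = r • u.1 := fun x hx => by
      have h1 : ‖x.1 - r • u.1‖ ^ 2 = 0 := by
        rw [norm_sub_sq_real, inner_smul_right, norm_smul, real_inner_comm, hx]
        simp only [norm_eq_of_mem_sphere, Real.norm_eq_abs, mul_one, sq_abs]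
        linarith
      exact sub_eq_zero.1 (norm_eq_zero.1 (pow_eq_zero_iff two_ne_zero |>.1 h1))
    exact fun x hx y hy => Subtype.ext ((this x hx).trans (this y hy).symm)
  let ψ : ℕ → ℝ → ℝ := fun m t => Real.arctan ((m + 1) * (t - r)) / (m + 1)
  let ψ' : ℕ → ℝ → ℝ := fun m t => 1 / (1 + ((m + 1) * (t - r)) ^ 2)
  have hd : ∀ m t, HasDerivAt (ψ m) (ψ' m t) t := fun m t => by
    have h1 : HasDerivAt (fun t : ℝ => ((m : ℝ) + 1) * (t - r)) ((m + 1) * 1) t :=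
      ((hasDerivAt_id t).sub_const r).const_mul _
    have h2 := h1.arctan.div_const ((m : ℝ) + 1)
    refine h2.congr_deriv ?_
    simp only [ψ']
    field_simp
  have hψ' : ∀ m, Continuous (ψ' m) := fun m => by
    have : ∀ t : ℝ, 1 + (((m : ℝ) + 1) * (t - r)) ^ 2 ≠ 0 := fun t => by positivity
    exact continuous_const.div (by fun_prop) this
  have hψ : ∀ m, Continuous (ψ m) := fun m =>
    (Real.continuous_arctan.comp (by fun_prop)).div_const _
  have hlip : ∀ m, LocallyLipschitz (ψ m) := fun m => by
    refine ContDiff.locallyLipschitz (𝕂 := ℝ) ?_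
    rw [contDiff_one_iff_deriv]
    exact ⟨fun t => (hd m t).differentiableAt, by
      rw [show deriv (ψ m) = ψ' m from funext fun t => (hd m t).deriv]; exact hψ' m⟩
  have hg := fun m => (integral_green_zonal μ hμ u u (ψ m) (fun _ => 1) (ψ' m) (fun _ => 0)
    (exists_lipschitzOnWith_Icc (hlip m)) ⟨_, (LipschitzWith.const 1).lipschitzOnWith⟩
    (ae_of_all _ fun x => hd m _) (ae_of_all _ fun x => hasDerivAt_const _ _)
    (hψ' m).measurable measurable_const).2
  simp only [mul_one, mul_zero, zero_mul, add_zero] at hg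
  have hlim : Tendsto (fun m : ℕ => (m : ℝ) + 1) atTop atTop :=
    tendsto_atTop_add_const_right _ _ tendsto_natCast_atTop_atTop
  have key : Tendsto (fun m => ∫ x : UnitSphere n, ((1 - inner ℝ u.1 x.1 ^ 2) *
      ψ' m (inner ℝ u.1 x.1) - (n - 1) * inner ℝ u.1 x.1 * ψ m (inner ℝ u.1 x.1)) ∂μ) atTop
      (𝓝 (∫ x, {x : UnitSphere n | (inner ℝ u.1 x.1 : ℝ) = r}.indicator
        (fun _ => 1 - r ^ 2) x ∂μ)) := by
    refine tendsto_integral_of_dominated_convergence (fun _ => 1 + |(n : ℝ) - 1| * (Real.pi / 2))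
      (fun m => ?_) (integrable_const _) (fun m => ae_of_all _ fun x => ?_)
      (ae_of_all _ fun x => ?_)
    · have h1 := (hψ' m).comp hcont
      have h2 := (hψ m).comp hcont
      simp only [Function.comp_def] at h1 h2
      exact Continuous.aestronglyMeasurable (by fun_prop)
    · have ht := abs_le.2 (inner_mem_Icc u x)
      generalize (inner ℝ u.1 x.1 : ℝ) = t at *
      have h1 : |1 - t ^ 2| ≤ 1 := by
        rw [abs_le]; have := sq_abs t; constructor <;> nlinarith [abs_nonneg t]
      have h2 : |ψ' m t| ≤ 1 := by
        rw [abs_of_nonneg (by positivity)]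
        exact div_le_one_of_le₀ (by nlinarith [sq_nonneg (((m : ℝ) + 1) * (t - r))])
          (by positivity)
      have h3 : |ψ m t| ≤ Real.pi / 2 := by
        simp only [ψ]
        rw [abs_div, abs_of_pos (show (0 : ℝ) < m + 1 by positivity)]
        refine (div_le_self (abs_nonneg _) (by simp)).trans ?_
        rw [abs_le]
        exact ⟨(Real.neg_pi_div_two_lt_arctan _).le, (Real.arctan_lt_pi_div_two _).le⟩
      rw [Real.norm_eq_abs]
      refine (abs_sub _ _).trans ?_
      simp only [abs_mul]
      have h4 : |1 - t ^ 2| * |ψ' m t| ≤ 1 * 1 := by gcongr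
      have h5 : |(n : ℝ) - 1| * |t| * |ψ m t| ≤ |(n : ℝ) - 1| * 1 * (Real.pi / 2) := by gcongr
      linarith
    · have h1 : Tendsto (fun m => ψ m (inner ℝ u.1 x.1)) atTop (𝓝 0) := by
        refine squeeze_zero_norm (a := fun m : ℕ => (Real.pi / 2) / ((m : ℝ) + 1)) (fun m => ?_)
          (tendsto_const_nhds.div_atTop hlim)
        simp only [ψ]
        rw [Real.norm_eq_abs, abs_div, abs_of_pos (show (0 : ℝ) < m + 1 by positivity)]
        gcongr
        rw [abs_le]
        exact ⟨(Real.neg_pi_div_two_lt_arctan _).le, (Real.arctan_lt_pi_div_two _).le⟩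
      by_cases hx : (inner ℝ u.1 x.1 : ℝ) = r
      · rw [Set.indicator_of_mem (show x ∈ {x : UnitSphere n | (inner ℝ u.1 x.1 : ℝ) = r} from hx)]
        simp [ψ', ψ, hx]
      · rw [Set.indicator_of_notMem
          (show x ∉ {x : UnitSphere n | (inner ℝ u.1 x.1 : ℝ) = r} from hx)]
        have h2 : Tendsto (fun m => ψ' m (inner ℝ u.1 x.1)) atTop (𝓝 0) := by
          refine tendsto_const_nhds.div_atTop (tendsto_atTop_add_const_left _ _ ?_)
          simp only [mul_pow]
          exact ((tendsto_pow_atTop two_ne_zero).comp hlim).atTop_mul_const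
            (by have := sub_ne_zero.2 hx; positivity)
        simpa using (h2.const_mul (1 - (inner ℝ u.1 x.1 : ℝ) ^ 2)).sub
          (h1.const_mul (((n : ℝ) - 1) * inner ℝ u.1 x.1))
  simp only [hg] at key
  have h0 := tendsto_nhds_unique key tendsto_const_nhds
  rw [integral_indicator hmeas, setIntegral_const, smul_eq_mul, mul_eq_zero] at h0
  have h1 := h0.resolve_right fun h => hr (by linarith)
  rwa [measureReal_eq_zero_iff] at h1

/-! ### Integrals of eigenfunctions over caps. -/

theorem hasDerivAt_eval_max (p : Polynomial ℝ) {s t : ℝ} (h : t ≠ s) :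
    HasDerivAt (fun t => p.eval (max t s)) (if s < t then p.derivative.eval t else 0) t := by
  rcases h.lt_or_gt with h | h
  · rw [if_neg h.le.not_gt]
    refine (hasDerivAt_const t (p.eval s)).congr_of_eventuallyEq ?_
    filter_upwards [Iio_mem_nhds h] with y hy
    rw [max_eq_right (le_of_lt hy)]
  · rw [if_pos h]
    refine (p.hasDerivAt t).congr_of_eventuallyEq ?_
    filter_upwards [Ioi_mem_nhds h] with y hy
    rw [max_eq_left (le_of_lt hy)]

theorem locallyLipschitz_eval (p : Polynomial ℝ) : LocallyLipschitz fun t => p.eval t :=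
  ContDiff.locallyLipschitz (𝕂 := ℝ) (by simpa using p.contDiff_aeval (𝕜 := ℝ) 1)

theorem locallyLipschitz_eval_max (p : Polynomial ℝ) (s : ℝ) :
    LocallyLipschitz fun t => p.eval (max t s) :=
  (locallyLipschitz_eval p).comp (LocallyLipschitz.id.max_const s)

theorem integral_zonal_eigenfunction {n : ℕ} (μ : Measure (UnitSphere n)) [IsFiniteMeasure μ]
    (hμ : IsRotationInvariant μ) (Q : Polynomial ℝ) (l : ℝ) (hl : l ≠ 0)
    (hQ : ∀ t, (1 - t ^ 2) * Q.derivative.derivative.eval t - (n - 1) * t * Q.derivative.eval t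
        = - l * Q.eval t) (e : UnitSphere n) :
    ∫ x : UnitSphere n, Q.eval (inner ℝ e.1 x.1 : ℝ) ∂μ = 0 := by
  have h := (integral_green_zonal μ hμ e e (fun t => Q.derivative.eval t) (fun _ => 1)
    (fun t => Q.derivative.derivative.eval t) (fun _ => 0)
    (exists_lipschitzOnWith_Icc (locallyLipschitz_eval _))
    ⟨_, (LipschitzWith.const 1).lipschitzOnWith⟩
    (ae_of_all _ fun x => Q.derivative.hasDerivAt _) (ae_of_all _ fun x => hasDerivAt_const _ _)
    (Polynomial.continuous _).measurable measurable_const).2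
  simp only [mul_one, mul_zero, zero_mul, add_zero, hQ, integral_const_mul] at h
  exact (mul_eq_zero.1 h).resolve_left (neg_ne_zero.2 hl)

/-- A zonal eigenfunction of the Laplacian integrates to zero over each cap whose height is a
critical point of its profile. -/
theorem setIntegral_cap_zonal_eigenfunction {n : ℕ} (μ : Measure (UnitSphere n))
    [IsFiniteMeasure μ] [NullSingletonClass μ]
    (hμ : IsRotationInvariant μ) (Q : Polynomial ℝ) (l s : ℝ) (hl : l ≠ 0)
    (hs : Q.eval s ≠ 0) (hs' : Q.derivative.eval s = 0)
    (hQ : ∀ t, (1 - t ^ 2) * Q.derivative.derivative.eval t - (n - 1) * t * Q.derivative.eval t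
        = - l * Q.eval t) (u e : UnitSphere n) :
    ∫ x in cap s u, Q.eval (inner ℝ e.1 x.1 : ℝ) ∂μ = 0 := by
  have hcapm : MeasurableSet (cap s u) :=
    (isClosed_le continuous_const (continuous_const.inner continuous_subtype_val)).measurableSet
  let Φ : Polynomial ℝ := 1 - Polynomial.C (Q.eval s)⁻¹ * Q
  have hΦ : ∀ t, Φ.eval t = 1 - (Q.eval s)⁻¹ * Q.eval t := fun t => by simp [Φ]
  have hΦ1 : ∀ t, Φ.derivative.eval t = - ((Q.eval s)⁻¹ * Q.derivative.eval t) := fun t => by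
    simp [Φ]
  have hΦ2 : ∀ t, Φ.derivative.derivative.eval t =
      - ((Q.eval s)⁻¹ * Q.derivative.derivative.eval t) := fun t => by simp [Φ]
  have hne : ∀ᵐ x : UnitSphere n ∂μ, (inner ℝ u.1 x.1 : ℝ) ≠ s :=
    measure_eq_zero_iff_ae_notMem.1 (measure_zonal_level_eq_zero μ hμ u s)
  have hmeas : ∀ p : Polynomial ℝ, Measurable fun t => if s < t then p.eval t else 0 := fun p =>
    Measurable.ite measurableSet_Ioi p.continuous.measurable measurable_const
  -- With `v = Φ(max (u · x) s)` and `w = Q(e · x)`, the integrands of `g1` and `g2` are `w Δv + ∇v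
  -- · ∇w` and `v Δw + ∇v · ∇w`. Their difference is `l w` on the cap and zero off it, apart from
  -- the null set `u · x = s`.
  have g1 := integral_green_zonal μ hμ u e (fun t => Φ.derivative.eval (max t s))
    (fun t => Q.eval t) (fun t => if s < t then Φ.derivative.derivative.eval t else 0)
    (fun t => Q.derivative.eval t)
    (exists_lipschitzOnWith_Icc (locallyLipschitz_eval_max _ _))
    (exists_lipschitzOnWith_Icc (locallyLipschitz_eval _))
    (hne.mono fun x hx => hasDerivAt_eval_max _ hx) (ae_of_all _ fun x => Q.hasDerivAt _)
    (hmeas _) (Polynomial.continuous _).measurable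
  have g2 := integral_green_zonal μ hμ e u (fun t => Q.derivative.eval t)
    (fun t => Φ.eval (max t s)) (fun t => Q.derivative.derivative.eval t)
    (fun t => if s < t then Φ.derivative.eval t else 0)
    (exists_lipschitzOnWith_Icc (locallyLipschitz_eval _))
    (exists_lipschitzOnWith_Icc (locallyLipschitz_eval_max _ _))
    (ae_of_all _ fun x => Q.derivative.hasDerivAt _)
    (hne.mono fun x hx => hasDerivAt_eval_max _ hx)
    (Polynomial.continuous _).measurable (hmeas _)
  simp only at g1 g2
  have g := integral_sub g1.1 g2.1
  rw [g1.2, g2.2, sub_zero] at g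
  have hcongr : ∫ x, (cap s u).indicator (fun x => l * Q.eval (inner ℝ e.1 x.1 : ℝ)) x ∂μ = 0 := by
    rw [← g]
    refine integral_congr_ae (hne.mono fun x hx => ?_)
    simp only
    rw [real_inner_comm e.1 u.1]
    have hcap : x ∈ cap s u ↔ s ≤ (inner ℝ u.1 x.1 : ℝ) := Iff.rfl
    by_cases hxc : x ∈ cap s u
    · rw [Set.indicator_of_mem hxc]
      have hlt := lt_of_le_of_ne (hcap.1 hxc) hx.symm
      rw [if_pos hlt, if_pos hlt, max_eq_left hlt.le, hΦ, hΦ1, hΦ2]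
      have h1 := hQ (inner ℝ u.1 x.1)
      have h2 := hQ (inner ℝ e.1 x.1)
      rw [h2]
      linear_combination (Q.eval s)⁻¹ * Q.eval (inner ℝ e.1 x.1 : ℝ) * h1
    · rw [Set.indicator_of_notMem hxc]
      have hlt := not_le.1 (mt hcap.2 hxc)
      rw [if_neg hlt.le.not_gt, if_neg hlt.le.not_gt, max_eq_right hlt.le, hΦ, hΦ1, hs',
        inv_mul_cancel₀ hs]
      ring
  rw [integral_indicator hcapm, integral_const_mul] at hcongr
  exact (mul_eq_zero.1 hcongr).resolve_left hl

/-! ### The Hausdorff measure of the sphere is finite and positive. -/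

theorem norm_normalize_sub_normalize_le {E : Type*} [NormedAddCommGroup E] [NormedSpace ℝ E]
    {x y : E} (hx : 1 ≤ ‖x‖) (hy : 1 ≤ ‖y‖) :
    ‖‖x‖⁻¹ • x - ‖y‖⁻¹ • y‖ ≤ 2 * ‖x - y‖ := by
  have hx0 : 0 < ‖x‖ := by linarith
  have hy0 : 0 < ‖y‖ := by linarith
  have hxi : ‖x‖⁻¹ ≤ 1 := inv_le_one_of_one_le₀ hx
  calc ‖‖x‖⁻¹ • x - ‖y‖⁻¹ • y‖
      = ‖‖x‖⁻¹ • (x - y) + (‖x‖⁻¹ * (‖y‖ - ‖x‖) * ‖y‖⁻¹) • y‖ := by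
        congr 1
        have : ‖x‖⁻¹ * (‖y‖ - ‖x‖) * ‖y‖⁻¹ = ‖x‖⁻¹ - ‖y‖⁻¹ := by field_simp
        rw [this, smul_sub, sub_smul]; abel
    _ ≤ ‖x‖⁻¹ * ‖x - y‖ + ‖x‖⁻¹ * ‖x - y‖ := by
        refine (norm_add_le _ _).trans (add_le_add ?_ ?_)
        · rw [norm_smul, norm_inv, norm_norm]
        · rw [norm_smul, norm_mul, norm_mul, norm_inv, norm_inv, norm_norm, norm_norm,
            mul_assoc, inv_mul_cancel₀ hy0.ne', mul_one, Real.norm_eq_abs]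
          gcongr
          rw [norm_sub_rev]
          exact abs_norm_sub_norm_le y x
    _ ≤ 1 * ‖x - y‖ + 1 * ‖x - y‖ := by gcongr
    _ = _ := by ring

/-- The point of a face of the cube `[-1, 1]^(m+1)` with given coordinates in the face. -/
noncomputable def cubeFace {m : ℕ} (i : Fin (m + 1)) (σ : ℝ) (y : Fin m → ℝ) :
    EuclideanSpace ℝ (Fin (m + 1)) :=
  WithLp.toLp 2 (i.insertNth σ y)

theorem exists_lipschitzWith_cubeFace {m : ℕ} (i : Fin (m + 1)) (σ : ℝ) :
    ∃ K, LipschitzWith K (cubeFace i σ) := by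
  have h : LipschitzWith 1 (fun y : Fin m → ℝ => (i.insertNth σ y : Fin (m + 1) → ℝ)) := by
    refine LipschitzWith.of_dist_le_mul fun y z => ?_
    rw [NNReal.coe_one, one_mul, dist_pi_le_iff dist_nonneg, Fin.forall_iff_succAbove i]
    simpa using fun j => dist_le_pi_dist y z j
  exact ⟨_, (PiLp.lipschitzWith_toLp 2 (fun _ : Fin (m + 1) => ℝ)).comp h⟩

theorem abs_le_norm_cubeFace {m : ℕ} (i : Fin (m + 1)) (σ : ℝ) (y : Fin m → ℝ) :
    |σ| ≤ ‖cubeFace i σ y‖ := by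
  simpa [cubeFace] using PiLp.norm_apply_le (cubeFace i σ y) i

/-- Radial projection of the cube's boundary covers the sphere by finitely many Lipschitz images of
`m`-dimensional cubes. -/
theorem hausdorffMeasure_sphere_lt_top (m : ℕ) :
    Measure.hausdorffMeasure (m : ℝ) (Set.univ : Set (UnitSphere (m + 1))) < ⊤ := by
  let σ : Bool → ℝ := fun b => if b then 1 else -1
  have hσ : ∀ b, |σ b| = 1 := by intro b; cases b <;> simp [σ]
  have hn : ∀ i b (y : Fin m → ℝ), 1 ≤ ‖cubeFace i (σ b) y‖ := fun i b y =>
    (hσ b).ge.trans (abs_le_norm_cubeFace i _ y)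
  let f : Fin (m + 1) × Bool → (Fin m → ℝ) → UnitSphere (m + 1) := fun p y =>
    ⟨‖cubeFace p.1 (σ p.2) y‖⁻¹ • cubeFace p.1 (σ p.2) y, by
      have := hn p.1 p.2 y
      rw [mem_sphere_zero_iff_norm, norm_smul, norm_inv, norm_norm, inv_mul_cancel₀ (by linarith)]⟩
  have hf : ∀ p, ∃ K, LipschitzWith K (f p) := fun p => by
    obtain ⟨K, hK⟩ := exists_lipschitzWith_cubeFace p.1 (σ p.2)
    refine ⟨2 * K, LipschitzWith.of_dist_le_mul fun y z => ?_⟩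
    rw [Subtype.dist_eq, dist_eq_norm]
    refine (norm_normalize_sub_normalize_le (hn p.1 p.2 y) (hn p.1 p.2 z)).trans ?_
    have := hK.dist_le_mul y z
    rw [dist_eq_norm] at this
    push_cast
    linarith
  have hcov : (Set.univ : Set (UnitSphere (m + 1))) ⊆ ⋃ p, f p '' Metric.closedBall 0 1 := by
    intro x _
    obtain ⟨i, hi⟩ := Finite.exists_max fun i => |x.1 i|
    have hpos : 0 < |x.1 i| := by
      refine lt_of_le_of_ne (abs_nonneg _) fun h => ?_
      have h0 : x.1 = 0 := by
        ext j
        have := hi j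
        rw [← h] at this
        simpa using this
      have := norm_eq_of_mem_sphere x
      simp [h0] at this
    obtain ⟨b, hb⟩ : ∃ b, σ b = x.1 i / |x.1 i| := by
      rcases abs_choice (x.1 i) with h | h
      · exact ⟨true, by rw [h]; rw [h] at hpos; simp [σ, hpos.ne']⟩
      · exact ⟨false, by rw [h, div_neg, div_self (by rintro h0; simp [h0] at hpos)]; simp [σ]⟩
    let y : Fin m → ℝ := fun j => x.1 (i.succAbove j) / |x.1 i|
    have hc : cubeFace i (σ b) y = |x.1 i|⁻¹ • x.1 := by
      ext j
      rcases Fin.eq_self_or_eq_succAbove i j with rfl | ⟨j, rfl⟩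
      · simp [cubeFace, hb, div_eq_inv_mul]
      · simp [cubeFace, y, div_eq_inv_mul]
    refine Set.mem_iUnion.2 ⟨(i, b), y, ?_, ?_⟩
    · rw [mem_closedBall_zero_iff, pi_norm_le_iff_of_nonneg zero_le_one]
      intro j
      rw [Real.norm_eq_abs, abs_div, abs_abs]
      exact div_le_one_of_le₀ (hi _) (abs_nonneg _)
    · apply Subtype.ext
      simp only [f]
      rw [hc, norm_smul, norm_eq_of_mem_sphere x, norm_inv, Real.norm_eq_abs, abs_abs, mul_one,
        inv_inv, smul_smul, mul_inv_cancel₀ hpos.ne', one_smul]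
  refine (measure_mono hcov).trans_lt ((measure_iUnion_le _).trans_lt ?_)
  rw [tsum_fintype]
  refine ENNReal.sum_lt_top.2 fun p _ => ?_
  obtain ⟨K, hK⟩ := hf p
  refine (hK.hausdorffMeasure_image_le m.cast_nonneg _).trans_lt (ENNReal.mul_lt_top ?_ ?_)
  · exact ENNReal.rpow_lt_top_of_nonneg m.cast_nonneg ENNReal.coe_ne_top
  · have := hausdorffMeasure_pi_real (ι := Fin m)
    rw [Fintype.card_fin] at this
    rw [this]
    exact measure_closedBall_lt_top

/-- Dropping the first coordinate is 1-Lipschitz, and the image contains the open Euclidean unit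
ball of `ℝᵐ`. -/
theorem hausdorffMeasure_sphere_pos (m : ℕ) :
    0 < Measure.hausdorffMeasure (m : ℝ) (Set.univ : Set (UnitSphere (m + 1))) := by
  let π : UnitSphere (m + 1) → (Fin m → ℝ) := fun x j => x.1 j.succ
  have hπ : LipschitzWith 1 π := by
    refine LipschitzWith.of_dist_le_mul fun x y => ?_
    rw [NNReal.coe_one, one_mul, dist_pi_le_iff dist_nonneg]
    intro j
    rw [Subtype.dist_eq, dist_eq_norm, dist_eq_norm]
    exact PiLp.norm_apply_le (x.1 - y.1) j.succ
  let U : Set (Fin m → ℝ) := {y | ∑ j, y j ^ 2 < 1}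
  have hU : IsOpen U := isOpen_lt (by fun_prop) continuous_const
  have hUpos : 0 < volume U := hU.measure_pos volume ⟨0, by simp [U]⟩
  have hsub : U ⊆ π '' Set.univ := by
    intro y hy
    refine ⟨⟨WithLp.toLp 2 (Fin.cons (Real.sqrt (1 - ∑ j, y j ^ 2)) y), ?_⟩, trivial, ?_⟩
    · have hy' : ∑ j, y j ^ 2 < 1 := hy
      rw [mem_sphere_zero_iff_norm, EuclideanSpace.norm_eq, Real.sqrt_eq_one]
      simp only [Fin.sum_univ_succ, Fin.cons_zero, Fin.cons_succ, Real.norm_eq_abs, sq_abs]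
      rw [Real.sq_sqrt (by linarith)]
      ring
    · funext j
      simp [π]
  have h := hπ.hausdorffMeasure_image_le (d := m) m.cast_nonneg Set.univ
  have hv := hausdorffMeasure_pi_real (ι := Fin m)
  rw [Fintype.card_fin] at hv
  rw [hv] at h
  have h2 := hUpos.trans_le ((measure_mono hsub).trans h)
  simpa using h2

theorem isProbabilityMeasure_sphereProb (n : ℕ) (hn : 1 ≤ n) :
    IsProbabilityMeasure (sphereProb n) := by
  obtain ⟨m, rfl⟩ := Nat.exists_eq_add_of_le' hn
  constructor
  rw [sphereProb, show ((m + 1 : ℕ) : ℝ) - 1 = m by push_cast; ring, Measure.smul_apply,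
    smul_eq_mul]
  exact ENNReal.inv_mul_cancel (hausdorffMeasure_sphere_pos m).ne'
    (hausdorffMeasure_sphere_lt_top m).ne

theorem nullSingletonClass_sphereProb (n : ℕ) (hn : 2 ≤ n) :
    NullSingletonClass (sphereProb n) := by
  have h : (0 : ℝ) < (n : ℝ) - 1 := by
    have : (2 : ℝ) ≤ n := by exact_mod_cast hn
    linarith
  have := Measure.nullSingletonClass_hausdorff (UnitSphere n) h
  exact ⟨fun x => by simp [sphereProb]⟩

/-! ### Perturbing the density and sampling. -/

theorem measure_zonal_zeros_eq_zero {n : ℕ} (μ : Measure (UnitSphere n)) [IsFiniteMeasure μ]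
    [NullSingletonClass μ] (hμ : IsRotationInvariant μ) (Q : Polynomial ℝ) (hQ : Q ≠ 0)
    (e : UnitSphere n) :
    μ {x : UnitSphere n | Q.eval (inner ℝ e.1 x.1 : ℝ) = 0} = 0 := by
  refine measure_mono_null (t := ⋃ r ∈ Q.roots.toFinset, {x | (inner ℝ e.1 x.1 : ℝ) = r})
    (fun x hx => ?_)
    ((measure_biUnion_null_iff (Finset.countable_toSet _)).2
      fun r _ => measure_zonal_level_eq_zero μ hμ e r)
  simpa [hQ] using hx

theorem measureReal_withDensity_one_add {X : Type*} [MeasurableSpace X] (μ : Measure X)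
    [IsProbabilityMeasure μ] (h : X → ℝ) (hi : Integrable h μ) (hpos : ∀ x, 0 ≤ 1 + h x)
    {A : Set X} (hA : MeasurableSet A) :
    (μ.withDensity fun x => ENNReal.ofReal (1 + h x)).real A = μ.real A + ∫ x in A, h x ∂μ := by
  have h1 : IntegrableOn (fun _ => (1 : ℝ)) A μ := integrable_const 1
  have h2 : IntegrableOn h A μ := hi.integrableOn
  rw [measureReal_def, withDensity_apply _ hA,
    ← ofReal_integral_eq_lintegral_ofReal (f := fun x => 1 + h x) (h1.add h2)
    (ae_of_all _ hpos), ENNReal.toReal_ofReal (integral_nonneg hpos), integral_add h1 h2]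
  simp

theorem exists_seq_tendsto_frequency {n : ℕ} (μ : Measure (UnitSphere n))
    [IsProbabilityMeasure μ] [NullSingletonClass μ] (hμ : IsRotationInvariant μ)
    (Q : Polynomial ℝ) (hQ0 : Q ≠ 0) (s : ℝ) (e : UnitSphere n)
    (hQi : ∫ x : UnitSphere n, Q.eval (inner ℝ e.1 x.1 : ℝ) ∂μ = 0)
    (hcap : ∀ u : UnitSphere n, ∫ x in cap s u, Q.eval (inner ℝ e.1 x.1 : ℝ) ∂μ = 0) :
    ∃ x : ℕ → UnitSphere n,
      (∀ u, Tendsto (frequency x (cap s u)) atTop (𝓝 (μ.real (cap s u)))) ∧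
      ¬ IsUniformlyDistributed μ x := by
  have hcont : ∀ v : UnitSphere n, Continuous fun x : UnitSphere n => (inner ℝ v.1 x.1 : ℝ) :=
    fun v => continuous_const.inner continuous_subtype_val
  set h : UnitSphere n → ℝ := fun x => Q.eval (inner ℝ e.1 x.1 : ℝ) with hh
  have hc : Continuous h := Q.continuous.comp (hcont e)
  have hi : Integrable h μ := (BoundedContinuousFunction.mkOfCompact ⟨h, hc⟩).integrable μ
  obtain ⟨M, hM⟩ : ∃ M, ∀ x, |h x| ≤ M := by
    obtain ⟨M, hM⟩ := isCompact_univ.exists_bound_of_continuousOn hc.continuousOn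
    exact ⟨M, fun x => hM x trivial⟩
  have hM0 : 0 ≤ M := (abs_nonneg _).trans (hM e)
  have hpos : ∀ x, 0 ≤ 1 + (M + 1)⁻¹ * h x := fun x => by
    have h1 : |(M + 1)⁻¹ * h x| ≤ 1 := by
      rw [abs_mul, abs_of_pos (show 0 < (M + 1)⁻¹ by positivity)]
      exact inv_mul_le_one_of_le₀ ((hM x).trans (by linarith)) (by positivity)
    linarith [(abs_le.1 h1).1]
  -- The factor `(M + 1)⁻¹` keeps the density nonnegative and is itself positive even if `M = 0`.
  let ν := μ.withDensity fun x => ENNReal.ofReal (1 + (M + 1)⁻¹ * h x)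
  have hν : ∀ {A : Set (UnitSphere n)}, MeasurableSet A →
      ν.real A = μ.real A + (M + 1)⁻¹ * ∫ x in A, h x ∂μ := fun {A} hA => by
    rw [← integral_const_mul]
    exact measureReal_withDensity_one_add μ _ (hi.const_mul _) hpos hA
  have hνμ : ν ≪ μ := withDensity_absolutelyContinuous _ _
  have hνp : IsProbabilityMeasure ν := by
    constructor
    have := hν MeasurableSet.univ
    rw [setIntegral_univ, hQi, mul_zero, add_zero, measureReal_def, probReal_univ] at this
    exact (ENNReal.toReal_eq_one_iff _).1 this
  obtain ⟨x, hx⟩ := exists_seq_tendsto_average ν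
  have hx' := isUniformlyDistributed_of_tendsto_average ν x hx
  refine ⟨x, fun u => ?_, fun hud => ?_⟩
  · have hm : MeasurableSet (cap s u) :=
      (isClosed_le continuous_const (hcont u)).measurableSet
    have hfr : μ (frontier (cap s u)) = 0 := by
      refine measure_mono_null ?_ (measure_zonal_level_eq_zero μ hμ u s)
      exact (frontier_le_subset_eq continuous_const (hcont u)).trans fun y hy => Eq.symm hy
    have := hx' (cap s u) hm (hνμ hfr)
    rwa [hν hm, hcap u, mul_zero, add_zero] at this
  -- This set separates `ν` from `μ`: equal masses would give `∫_A h = 0`, and since `h` has total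
  -- integral zero, `∫ |h| = 0`, although `h ≠ 0` almost everywhere.
  · let A : Set (UnitSphere n) := {y | 0 ≤ h y}
    have hA : MeasurableSet A := (isClosed_le continuous_const hc).measurableSet
    have hz : μ {y | h y = 0} = 0 := measure_zonal_zeros_eq_zero μ hμ Q hQ0 e
    have hfr : μ (frontier A) = 0 :=
      measure_mono_null ((frontier_le_subset_eq continuous_const hc).trans fun y hy => Eq.symm hy)
        hz
    have heq := tendsto_nhds_unique (hud A hfr) (hx' A hA (hνμ hfr))
    rw [hν hA] at heq
    have hA0 : ∫ y in A, h y ∂μ = 0 := by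
      have h1 : (M + 1)⁻¹ * ∫ y in A, h y ∂μ = 0 := by linarith
      exact (mul_eq_zero.1 h1).resolve_left (by positivity)
    have habs : ∫ y, |h y| ∂μ = 0 := by
      have : (fun y => |h y|) = fun y => 2 * A.indicator h y - h y := by
        funext y
        by_cases hy : y ∈ A
        · rw [Set.indicator_of_mem hy, abs_of_nonneg hy]; ring
        · rw [Set.indicator_of_notMem hy, abs_of_neg (not_le.1 hy)]; ring
      rw [this, integral_sub ((hi.indicator hA).const_mul 2) hi, integral_const_mul,
        integral_indicator hA, hA0, hQi]
      ring
    have hae := (integral_eq_zero_iff_of_nonneg (fun y => abs_nonneg (h y)) hi.abs).1 habs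
    have hne : ∀ᵐ y ∂μ, h y ≠ 0 := measure_eq_zero_iff_ae_notMem.1 hz
    obtain ⟨y, hy1, hy2⟩ := (hae.and hne).exists
    exact hy2 (abs_eq_zero.1 hy1)
end SphereCaps

theorem theorem3 (n : ℕ) (hn : 3 ≤ n) (k : ℕ) (hk : Even k) (s : ℝ)
    (hs : (SphereCaps.legendrePoly (n + 2) k).IsRoot s) :
    ∃ x : ℕ → SphereCaps.UnitSphere n,
      (∀ u : SphereCaps.UnitSphere n,
        Tendsto (SphereCaps.frequency x (SphereCaps.cap s u)) atTop
          (𝓝 ((SphereCaps.sphereProb n).real (SphereCaps.cap s u)))) ∧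
      ¬ SphereCaps.IsUniformlyDistributed (SphereCaps.sphereProb n) x := by
  obtain ⟨Q, l, hl, hQ0, hQs, hQs', hQ⟩ := SphereCaps.exists_zonal_eigenfunction n hn k s hs
  have := SphereCaps.isProbabilityMeasure_sphereProb n (by omega)
  have := SphereCaps.nullSingletonClass_sphereProb n (by omega)
  have hμ := SphereCaps.isRotationInvariant_sphereProb n
  let e : SphereCaps.UnitSphere n := ⟨EuclideanSpace.single ⟨0, by omega⟩ 1, by simp⟩
  exact SphereCaps.exists_seq_tendsto_frequency _ hμ Q hQ0 s e
    (SphereCaps.integral_zonal_eigenfunction _ hμ Q l hl hQ e)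
    fun u => SphereCaps.setIntegral_cap_zonal_eigenfunction _ hμ Q l s hl hQs hQs' hQ u e
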